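/- Let $h:\mathbb R\to\mathbb R$ be differentiable (the activation, applied coordinatewise to vectors), let $(u^i,v^i)\in\mathbb R^d\times\mathbb R$, $i=1,\dots,N$, be fixed data, and for $W\in\mathbb R^{d\times d}$, $\theta\in\mathbb R^d$ put $$f(W,\theta)=\frac1{2N}\sum_{i=1}^N\bigl(v^i-\theta^Th(Wu^i)\bigr)^2 .$$ Let $\mathcal R\subseteq\mathbb R^d$ be either $\mathcal R=\mathbb R^d$ or, provided $d\ge2$ and $N_i\ge2$, a Euclidean ball $\mathcal R=\{r:\|r\|_2\le R/2\}$ with $R>0$; let $P_x(y)=\operatorname{argmin}_{z\in\mathcal R}\{\langle y,z-x\rangle+\tfrac12\|z-x\|_2^2\}$. Let $N_i\ge1$ be the number of inner iterations, $\beta^k_1,\dots,\beta^k_{N_i}>0$ and $\gamma_k\in\mathbb R$ the (deterministic) step sizes. Algorithm 1 (SGD-GD) starts from a random pair $(W_0,\theta_0)\in\mathbb R^{d\times d}\times\mathbb R^d$ such that the law of $W_0$ is absolutely continuous with respect to Lebesgue measure. In outer iteration $k=0,1,2,\dots$ it sets $\overline\theta_1=\theta_k$, $$\overline\theta_{i+1}=P_{\overline\theta_i}\bigl(\beta^k_i\,[\nabla_\theta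 f(W_k,\overline\theta_i)+\xi^k_i]\bigr),\qquad i=1,\dots,N_i,$$ $$\theta_{k+1}=\Bigl(\sum_{\tau=1}^{N_i}\beta^k_\tau\Bigr)^{-1}\sum_{\tau=1}^{N_i}\beta^k_\tau\,\overline\theta_{\tau+1},\qquad W_{k+1}=W_k-\gamma_k\nabla_Wf(W_k,\theta_{k+1}).$$ Here all coordinates of all noise vectors $\xi^k_i\in\mathbb R^d$ ($k\ge0$, $1\le i\le N_i$) are i.i.d. centred Gaussian with a common positive variance, and the whole noise is independent of $(W_0,\theta_0)$. Then for every $k\ge0$ the event $\{\exists\,x\neq0:\ W_kx=0\}$ is measurable, and conditionally on the noise history it has probability zero: for every $m\ge0$, $$\mathsf P\bigl\{\exists\,x\ne0:\ W_kx=0\ \big|\ \xi^j_i,\ 0\le j<m,\ 1\le i\le N_i\bigr\}=0\quad\text{almost surely},$$ and the same holds when one conditions in addition on the initialization $(W_0,\theta_0)$. In particular this holds when one conditions on all noise preceding the outer iteration that produces $W_k$, so that the remaining randomness is the Gaussian noise of the inner SGD loop. -/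

import Mathlib

open MeasureTheory ProbabilityTheory
open scoped Matrix NNReal ENNReal InnerProductSpace

noncomputable section

namespace TwoLayer

variable {d N n : ℕ}

/-- Matrices carry the product σ-algebra of their entries. -/
instance : MeasurableSpace (Matrix (Fin d) (Fin d) ℝ) :=
  inferInstanceAs (MeasurableSpace (Fin d → Fin d → ℝ))

/-- The two-layer network `φ_{W,θ}(x) = θᵀ h(W x)`, the activation `h` acting coordinatewise. -/
def network (h : ℝ → ℝ) (W : Matrix (Fin d) (Fin d) ℝ) (θ : EuclideanSpace ℝ (Fin d))
    (x : Fin d → ℝ) : ℝ :=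
  ∑ j, θ j * h ((W *ᵥ x) j)

/-- The training loss `f(W,θ) = (1/2N) ∑ᵢ (vⁱ - φ_{W,θ}(uⁱ))²` of the data `(uⁱ, vⁱ)`. -/
def loss (h : ℝ → ℝ) (u : Fin N → Fin d → ℝ) (v : Fin N → ℝ)
    (W : Matrix (Fin d) (Fin d) ℝ) (θ : EuclideanSpace ℝ (Fin d)) : ℝ :=
  1 / (2 * (N : ℝ)) * ∑ i, (v i - network h W θ (u i)) ^ 2

/-- `∇_θ f(W,θ)`. -/
def gradTheta (h : ℝ → ℝ) (u : Fin N → Fin d → ℝ) (v : Fin N → ℝ)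
    (W : Matrix (Fin d) (Fin d) ℝ) (θ : EuclideanSpace ℝ (Fin d)) : EuclideanSpace ℝ (Fin d) :=
  gradient (fun θ' => loss h u v W θ') θ

/-- `∇_W f(W,θ)`: the matrix of the partial derivatives of `f` in the entries of `W`. -/
def gradW (h : ℝ → ℝ) (u : Fin N → Fin d → ℝ) (v : Fin N → ℝ)
    (W : Matrix (Fin d) (Fin d) ℝ) (θ : EuclideanSpace ℝ (Fin d)) : Matrix (Fin d) (Fin d) ℝ :=
  Matrix.of fun j k => deriv (fun t : ℝ => loss h u v (W + t • Matrix.single j k 1) θ) 0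

/-- The prox-mapping `P_x(y) = argmin_{z ∈ K} ⟨y, z - x⟩ + ½ ‖z - x‖²`; the minimizer exists and
is unique when `K` is nonempty, closed and convex. -/
def prox (K : Set (EuclideanSpace ℝ (Fin d))) (x y : EuclideanSpace ℝ (Fin d)) :
    EuclideanSpace ℝ (Fin d) :=
  Classical.epsilon fun z =>
    z ∈ K ∧ IsMinOn (fun z' => ⟪y, z' - x⟫_ℝ + 1 / 2 * ‖z' - x‖ ^ 2) K z

/-- The `n + 1` iterates of the inner loop (noisy projected gradient descent in `θ`, with `W`
frozen), started at `θ`, with step sizes `β` and noise vectors `z`. Indices start at `0`. -/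
def innerIter (h : ℝ → ℝ) (u : Fin N → Fin d → ℝ) (v : Fin N → ℝ)
    (K : Set (EuclideanSpace ℝ (Fin d))) (β : Fin n → ℝ) (W : Matrix (Fin d) (Fin d) ℝ)
    (θ : EuclideanSpace ℝ (Fin d)) (z : Fin n → EuclideanSpace ℝ (Fin d)) :
    Fin (n + 1) → EuclideanSpace ℝ (Fin d) :=
  fun i => Fin.induction (motive := fun _ => EuclideanSpace ℝ (Fin d)) θ
    (fun i x => prox K x (β i • (gradTheta h u v W x + z i))) i

/-- The output of the inner loop: the `β`-weighted average of all iterates after the first. -/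
def innerAvg (h : ℝ → ℝ) (u : Fin N → Fin d → ℝ) (v : Fin N → ℝ)
    (K : Set (EuclideanSpace ℝ (Fin d))) (β : Fin n → ℝ) (W : Matrix (Fin d) (Fin d) ℝ)
    (θ : EuclideanSpace ℝ (Fin d)) (z : Fin n → EuclideanSpace ℝ (Fin d)) :
    EuclideanSpace ℝ (Fin d) :=
  (∑ τ, β τ)⁻¹ • ∑ τ : Fin n, β τ • innerIter h u v K β W θ z τ.succ

/-- The state `(W_k, θ_k)` of the SGD-GD algorithm started at `(W₀, θ₀)`, where `z k i` is the noise
vector of the `i`-th inner step in the `k`-th outer iteration. -/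
def sgdGd (h : ℝ → ℝ) (u : Fin N → Fin d → ℝ) (v : Fin N → ℝ)
    (K : Set (EuclideanSpace ℝ (Fin d))) (β : ℕ → Fin n → ℝ) (γ : ℕ → ℝ)
    (W₀ : Matrix (Fin d) (Fin d) ℝ) (θ₀ : EuclideanSpace ℝ (Fin d))
    (z : ℕ → Fin n → EuclideanSpace ℝ (Fin d)) :
    ℕ → Matrix (Fin d) (Fin d) ℝ × EuclideanSpace ℝ (Fin d)
  | 0 => (W₀, θ₀)
  | k + 1 =>
    let s := sgdGd h u v K β γ W₀ θ₀ z k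
    let θ' := innerAvg h u v K (β k) s.1 s.2 (z k)
    (s.1 - γ k • gradW h u v s.1 θ', θ')

/-- The σ-algebra generated by all noise vectors of the outer iterations `0, …, m - 1`. -/
@[reducible] def noiseHistory {Ω : Type*} (ξ : ℕ → Fin n → Ω → EuclideanSpace ℝ (Fin d)) (m : ℕ) :
    MeasurableSpace Ω :=
  ⨆ j : Fin m, ⨆ i : Fin n, MeasurableSpace.comap (ξ j i) inferInstance

/-- The σ-algebra generated by the initialization and the noise vectors of the outer iterations
`0, …, m - 1`. -/
@[reducible] def fullHistory {Ω : Type*} (W₀ : Ω → Matrix (Fin d) (Fin d) ℝ)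
    (θ₀ : Ω → EuclideanSpace ℝ (Fin d)) (ξ : ℕ → Fin n → Ω → EuclideanSpace ℝ (Fin d)) (m : ℕ) :
    MeasurableSpace Ω :=
  MeasurableSpace.comap W₀ inferInstance ⊔ MeasurableSpace.comap θ₀ inferInstance ⊔
    noiseHistory ξ m

/-- The event that the hidden-layer matrix `W_k` has a nonzero vector in its kernel. -/
def singularEvent {Ω : Type*} (h : ℝ → ℝ) (u : Fin N → Fin d → ℝ) (v : Fin N → ℝ)
    (K : Set (EuclideanSpace ℝ (Fin d))) (β : ℕ → Fin n → ℝ) (γ : ℕ → ℝ)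
    (W₀ : Ω → Matrix (Fin d) (Fin d) ℝ) (θ₀ : Ω → EuclideanSpace ℝ (Fin d))
    (ξ : ℕ → Fin n → Ω → EuclideanSpace ℝ (Fin d)) (k : ℕ) : Set Ω :=
  {ω | ∃ x : Fin d → ℝ, x ≠ 0 ∧
    (sgdGd h u v K β γ (W₀ ω) (θ₀ ω) (fun j i => ξ j i ω) k).1 *ᵥ x = 0}

end TwoLayer

end

/-! `W_k` has a nontrivial kernel exactly when `det W_k = 0`. It suffices to show that this event is
null: an indicator that vanishes almost surely has conditional expectation zero whatever one
conditions on. The proof is an induction on `k`. For `k = 0`, `det` is a nonzero polynomial and the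
law of `W₀` is absolutely continuous.

For the step, freeze an invertible `W`. The function `F θ = det (W - γ • ∇_W f(W, θ))` is polynomial
in `θ`, although `h` is only differentiable, and `F 0 = det W ≠ 0` because the gradient vanishes at
`θ = 0`. A nonzero analytic function has a null zero set, so the inner average must be shown to
avoid that set almost surely.

Without constraint, the last noise vector enters the average affinely with a nonzero coefficient
(`ae_innerAvg_univ_ne_zero`). On a ball, projection can put positive mass on a sphere, and `F` might
vanish on one sphere. The last two iterates are therefore used together: in dimension at least two
the sum of two spheres has interior, so `F` cannot vanish on all of it
(`exists_sphere_add_sphere_ne_zero`, `ae_ae_ballProj_ne_zero`). Independence of the current noise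
from the current state and Fubini finish the step (`ae_det_sgdGd_ne_zero`). -/

section

open Filter Metric Set
open scoped Topology Pointwise

/-! ### Zero sets of real analytic functions. -/

/-- The ray-wise form of the analytic null set lemma: on a ball, the zero set of an analytic
function which does not vanish at the centre is null in the ball of half the radius. -/
theorem AnalyticOnNhd.measure_ball_half_inter_zero {E : Type*} [NormedAddCommGroup E]
    [NormedSpace ℝ E] [MeasurableSpace E] [BorelSpace E] [FiniteDimensional ℝ E]
    (μ : Measure E) [μ.IsAddHaarMeasure] {f : E → ℝ} {x₀ : E} {r : ℝ}
    (hf : AnalyticOnNhd ℝ f (ball x₀ r)) (h₀ : f x₀ ≠ 0) :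
    μ (ball x₀ (r / 2) ∩ {x | f x = 0}) = 0 := by
  rcases le_or_gt r 0 with hr | hr
  · simp [ball_eq_empty.2 (by linarith : r / 2 ≤ 0)]
  let g : ℝ × E → ℝ := fun p => f (x₀ + p.1 • p.2)
  have hmaps : ∀ p : ℝ × E, p ∈ Ioo (-1 : ℝ) 1 ×ˢ ball (0 : E) r →
      x₀ + p.1 • p.2 ∈ ball x₀ r := by
    rintro ⟨t, v⟩ ⟨ht, hv⟩
    simp only [mem_ball, dist_self_add_left, dist_zero_right, norm_smul, mem_Ioo] at *
    have : ‖t‖ ≤ 1 := by rw [Real.norm_eq_abs, abs_le]; constructor <;> linarith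
    nlinarith [norm_nonneg v]
  have hO : IsOpen (Ioo (-1 : ℝ) 1 ×ˢ ball (0 : E) r) := isOpen_Ioo.prod isOpen_ball
  have hg : ContinuousOn g (Ioo (-1 : ℝ) 1 ×ˢ ball (0 : E) r) :=
    hf.continuousOn.comp (by fun_prop) hmaps
  set Z : Set (ℝ × E) := (Ioo (-1 : ℝ) 1 ×ˢ ball (0 : E) r) ∩ {p | g p = 0} with hZ
  have hZm : MeasurableSet Z := by
    have h1 : Z = (Ioo (-1 : ℝ) 1 ×ˢ ball (0 : E) r) \
        ((Ioo (-1 : ℝ) 1 ×ˢ ball (0 : E) r) ∩ g ⁻¹' {0}ᶜ) := by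
      ext p; simp [hZ]
    rw [h1]
    exact hO.measurableSet.diff (hg.isOpen_inter_preimage hO isOpen_compl_singleton).measurableSet
  have hline : ∀ v : E, volume ((fun t : ℝ => (t, v)) ⁻¹' Z) = 0 := by
    intro v
    by_cases hv : v ∈ ball (0 : E) r
    swap
    · convert measure_empty (μ := (volume : Measure ℝ))
      ext t; simp only [hZ, mem_preimage, mem_inter_iff, mem_prod, mem_empty_iff_false, hv,
        and_false, false_and]
    have han : AnalyticOnNhd ℝ (fun t : ℝ => f (x₀ + t • v)) (Ioo (-1) 1) := by
      intro t ht
      have h1 : AnalyticAt ℝ f (x₀ + t • v) := hf _ (hmaps (t, v) ⟨ht, hv⟩)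
      exact h1.comp_of_eq (by fun_prop : AnalyticAt ℝ (fun t : ℝ => x₀ + t • v) t) rfl
    -- Every line passes through `x₀` at `t = 0`, where `f` is nonzero, so the zeros on it are
    -- isolated and hence null.
    rcases han.eqOn_zero_or_eventually_ne_zero_of_preconnected isPreconnected_Ioo with h | h
    · have := h (show (0 : ℝ) ∈ Ioo (-1 : ℝ) 1 by simp)
      simp at this
      exact absurd this h₀
    · have h2 := ae_restrict_le_codiscreteWithin (μ := (volume : Measure ℝ)) measurableSet_Ioo h
      rw [mem_ae_iff, Measure.restrict_apply₀'
        (measurableSet_Ioo.nullMeasurableSet)] at h2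
      refine measure_mono_null ?_ h2
      rintro t ⟨⟨ht, -⟩, h0⟩
      exact ⟨by simpa [g] using h0, ht⟩
  have hprod : (volume.prod μ) Z = 0 := by
    rw [Measure.prod_apply_symm hZm]
    simp [hline]
  rw [Measure.measure_prod_null hZm] at hprod
  have hpos : (volume : Measure ℝ) (Ioo (1 / 2 : ℝ) 1) ≠ 0 := by
    rw [Real.volume_Ioo]; norm_num
  -- Fubini in the other order gives a null slice at some fixed `t`. Requiring `t > 1 / 2` lets the
  -- homothety of ratio `t` cover the half ball from directions of norm less than `r`.
  obtain ⟨t, ht, hts⟩ : ∃ t ∈ Ioo (1 / 2 : ℝ) 1, μ (Prod.mk t ⁻¹' Z) = 0 := by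
    by_contra! hcon
    exact hpos (measure_mono_null (fun t ht => hcon t ht) hprod)
  have ht0 : 0 < t := by linarith [ht.1]
  have hsub : ball x₀ (r / 2) ∩ {x | f x = 0} ⊆ (x₀ + ·) '' (t • (Prod.mk t ⁻¹' Z)) := by
    rintro x ⟨hx, hfx⟩
    refine ⟨x - x₀, ⟨t⁻¹ • (x - x₀), ⟨⟨⟨by linarith, ht.2⟩, ?_⟩, ?_⟩, ?_⟩, by simp⟩
    · rw [mem_ball, dist_eq_norm] at hx
      simp only [mem_ball, dist_zero_right, norm_smul, norm_inv, Real.norm_eq_abs, abs_of_pos ht0]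
      rw [inv_mul_lt_iff₀ ht0]
      nlinarith [ht.1]
    · simpa [g, smul_smul, ht0.ne'] using hfx
    · simp [smul_smul, ht0.ne']
  refine measure_mono_null hsub ?_
  rw [image_add_left, measure_preimage_add, Measure.addHaar_smul, hts, mul_zero]

/-- The zero set of a nonzero real analytic function on a connected open set is null. -/
theorem AnalyticOnNhd.measure_inter_zero_of_isPreconnected {E : Type*} [NormedAddCommGroup E]
    [NormedSpace ℝ E] [MeasurableSpace E] [BorelSpace E] [FiniteDimensional ℝ E]
    (μ : Measure E) [μ.IsAddHaarMeasure] {f : E → ℝ} {U : Set E}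
    (hf : AnalyticOnNhd ℝ f U) (hU : IsOpen U) (hc : IsPreconnected U)
    (hne : ∃ x ∈ U, f x ≠ 0) : μ (U ∩ {x | f x = 0}) = 0 := by
  obtain ⟨x₁, hx₁, hfx₁⟩ := hne
  refine measure_null_of_locally_null _ fun x hx => ?_
  obtain ⟨ε, hε, hball⟩ := Metric.isOpen_iff.1 hU x hx.1
  have hfreq : ∃ᶠ y in 𝓝 x, f y ≠ 0 := by
    intro hev
    have : f =ᶠ[𝓝 x] 0 := by
      filter_upwards [hev] with y hy
      simpa using hy
    exact hfx₁ (hf.eqOn_zero_of_preconnected_of_eventuallyEq_zero hc hx.1 this hx₁)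
  -- With `x₀` within `ε / 4` of `x`, the ball of radius `ε / 2` about `x₀` stays in `U`, while its
  -- half still contains `x`.
  obtain ⟨x₀, hx₀, hx₀b⟩ := (hfreq.and_eventually (ball_mem_nhds x
    (show 0 < ε / 4 by positivity))).exists
  have hsub : ball x₀ (ε / 2) ⊆ U := by
    refine (ball_subset_ball' ?_).trans hball
    linarith
  refine ⟨ball x₀ (ε / 2 / 2) ∩ {x | f x = 0}, ?_,
    (hf.mono hsub).measure_ball_half_inter_zero μ hx₀⟩
  have h1 : ball x₀ (ε / 2 / 2) ∈ 𝓝 x := by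
    refine isOpen_ball.mem_nhds ?_
    rw [mem_ball, dist_comm]
    linarith
  filter_upwards [mem_nhdsWithin_of_mem_nhds h1, self_mem_nhdsWithin] with y hy1 hy2
  exact ⟨hy1, hy2.2⟩

theorem AnalyticOnNhd.ae_ne_zero {E : Type*} [NormedAddCommGroup E]
    [NormedSpace ℝ E] [MeasurableSpace E] [BorelSpace E] [FiniteDimensional ℝ E]
    (μ : Measure E) [μ.IsAddHaarMeasure] {f : E → ℝ}
    (hf : AnalyticOnNhd ℝ f univ) (hne : ∃ x, f x ≠ 0) : ∀ᵐ x ∂μ, f x ≠ 0 := by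
  have := hf.measure_inter_zero_of_isPreconnected μ isOpen_univ isPreconnected_univ (by simpa)
  rw [ae_iff]
  simpa using this

theorem ae_sub_smul {E : Type*} [NormedAddCommGroup E]
    [NormedSpace ℝ E] [MeasurableSpace E] [BorelSpace E] [FiniteDimensional ℝ E]
    (μ : Measure E) [μ.IsAddHaarMeasure] {p : E → Prop} (hp : ∀ᵐ y ∂μ, p y) (a : E) {b : ℝ}
    (hb : b ≠ 0) : ∀ᵐ z ∂μ, p (a - b • z) := by
  have h1 : Measure.QuasiMeasurePreserving (fun y : E => (-b) • y) μ μ := by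
    refine ⟨by fun_prop, ?_⟩
    rw [Measure.map_addHaar_smul μ (neg_ne_zero.2 hb)]
    exact Measure.smul_absolutelyContinuous
  have h2 := (measurePreserving_add_left μ a).quasiMeasurePreserving.comp h1
  filter_upwards [h2.ae hp] with z hz
  simpa [sub_eq_add_neg] using hz

/-! ### Spheres and the projection onto a ball. -/

section Sphere

variable {E : Type*} [NormedAddCommGroup E] [InnerProductSpace ℝ E]

/-- The metric projection onto the closed ball of radius `ρ` about the origin. -/
noncomputable def ballProj (ρ : ℝ) (y : E) : E := if ‖y‖ ≤ ρ then y else (ρ / ‖y‖) • y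

/-- Intermediate value theorem for `‖w - x‖` on the sphere `‖x‖ = r₁`, which is connected in
dimension at least two. The extreme values are attained at the multiples `± (r₁ / ‖w‖) • w`. -/
theorem exists_norm_eq_norm_sub_eq (hE : 1 < Module.rank ℝ E) {r₁ r₂ : ℝ} (h₁ : 0 < r₁) {w : E}
    (hl : |‖w‖ - r₁| ≤ r₂) (hr : r₂ ≤ ‖w‖ + r₁) (hw : w ≠ 0) : ∃ x : E, ‖x‖ = r₁ ∧ ‖w - x‖ = r₂ := by
  have hw' : 0 < ‖w‖ := norm_pos_iff.2 hw
  have hS := isPreconnected_sphere hE (0 : E) r₁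
  have hmem : ∀ σ : ℝ, |σ| = 1 → (σ * (r₁ / ‖w‖)) • w ∈ sphere (0 : E) r₁ := by
    intro σ hσ
    rw [mem_sphere_zero_iff_norm, norm_smul, Real.norm_eq_abs, abs_mul, hσ, abs_of_pos (by positivity)]
    field_simp
  have hval : ∀ σ : ℝ, ‖w - (σ * (r₁ / ‖w‖)) • w‖ = |‖w‖ - σ * r₁| := by
    intro σ
    have : w - (σ * (r₁ / ‖w‖)) • w = (1 - σ * (r₁ / ‖w‖)) • w := by rw [sub_smul, one_smul]
    rw [this, norm_smul, Real.norm_eq_abs, ← abs_of_pos hw', ← abs_mul, abs_of_pos hw']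
    congr 1; field_simp
  have hivt := hS.intermediate_value (hmem 1 (by simp)) (hmem (-1) (by simp))
    (f := fun x => ‖w - x‖) (by fun_prop)
  rw [hval, hval] at hivt
  obtain ⟨x, hx, hx2⟩ := hivt (show r₂ ∈ Icc _ _ from
    ⟨by simpa using hl, by rw [abs_of_pos (by linarith)]; linarith⟩)
  exact ⟨x, by simpa using hx, hx2⟩

/-- The sum of the two spheres contains an open set, so vanishing on it would force `F = 0` by the
identity theorem. -/
theorem exists_sphere_add_sphere_ne_zero (hE : 1 < Module.rank ℝ E) {F : E → ℝ}
    (hF : AnalyticOnNhd ℝ F univ) (hne : ∃ x, F x ≠ 0) (c : E) {r₁ r₂ : ℝ} (h₁ : 0 < r₁)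
    (h₂ : 0 < r₂) : ∃ x y : E, ‖x‖ = r₁ ∧ ‖y‖ = r₂ ∧ F (c + x + y) ≠ 0 := by
  by_contra! hcon
  have hnt : Nontrivial E := (rank_pos_iff_nontrivial (R := ℝ)).1 (zero_lt_one.trans hE)
  -- The norm `max r₁ r₂` makes both triangle inequalities strict, so they persist near `w₀`.
  obtain ⟨w₀, hw₀⟩ := exists_norm_eq E (le_max_of_le_left h₁.le : 0 ≤ max r₁ r₂)
  have h3 : |max r₁ r₂ - r₁| < r₂ := by
    rcases max_cases r₁ r₂ with ⟨h, h'⟩ | ⟨h, h'⟩ <;> rw [h, abs_lt] <;> constructor <;> linarith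
  have h4 : r₂ < max r₁ r₂ + r₁ := by linarith [le_max_right r₁ r₂]
  have h5 : 0 < max r₁ r₂ := lt_max_of_lt_left h₁
  have hev : ∀ᶠ w in 𝓝 w₀, |‖w‖ - r₁| < r₂ ∧ r₂ < ‖w‖ + r₁ ∧ 0 < ‖w‖ := by
    refine Filter.Eventually.and ?_ (Filter.Eventually.and ?_ ?_)
    · exact (show Continuous fun w : E => |‖w‖ - r₁| by fun_prop).continuousAt.eventually_lt
        continuousAt_const (by rwa [hw₀])
    · exact continuousAt_const.eventually_lt
        (show Continuous fun w : E => ‖w‖ + r₁ by fun_prop).continuousAt (by rwa [hw₀])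
    · exact continuousAt_const.eventually_lt continuous_norm.continuousAt (by rwa [hw₀])
  have hzero : ∀ᶠ w in 𝓝 w₀, F (c + w) = 0 := by
    filter_upwards [hev] with w ⟨hw1, hw2, hw3⟩
    obtain ⟨x, hx, hy⟩ := exists_norm_eq_norm_sub_eq hE h₁ hw1.le hw2.le (norm_pos_iff.1 hw3)
    simpa [add_assoc] using hcon x (w - x) hx hy
  have hF' : AnalyticOnNhd ℝ (fun w => F (c + w)) univ := fun w _ =>
    (hF (c + w) (mem_univ _)).comp_of_eq (by fun_prop : AnalyticAt ℝ (fun w => c + w) w) rfl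
  obtain ⟨x, hx⟩ := hne
  have := hF'.eqOn_zero_of_preconnected_of_eventuallyEq_zero isPreconnected_univ (mem_univ w₀)
    hzero (mem_univ (x - c))
  simp at this
  exact hx this

theorem analyticAt_div_norm_smul (ρ : ℝ) {y : E} (hy : y ≠ 0) :
    AnalyticAt ℝ (fun y : E => (ρ / ‖y‖) • y) y := by
  have h1 : AnalyticAt ℝ (fun y : E => ‖y‖) y := (contDiffAt_norm ℝ hy).analyticAt
  exact (analyticAt_const.div h1 (norm_ne_zero_iff.2 hy)).smul analyticAt_id

variable [FiniteDimensional ℝ E] [MeasurableSpace E] [BorelSpace E]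

/-- Both branches of the projection are analytic, the radial one on the complement of the origin,
which is connected. A witness of norm `ρ` is fixed by the radial map and so serves for both. -/
theorem ae_ballProj_ne_zero (μ : Measure E) [μ.IsAddHaarMeasure] (hE : 1 < Module.rank ℝ E)
    {F : E → ℝ} (hF : AnalyticOnNhd ℝ F univ) (c : E) {a ρ : ℝ} (hρ : 0 < ρ)
    (hne : ∃ x, ‖x‖ = ρ ∧ F (c + a • x) ≠ 0) : ∀ᵐ y ∂μ, F (c + a • ballProj ρ y) ≠ 0 := by
  obtain ⟨x, hx, hFx⟩ := hne
  have hlin : AnalyticOnNhd ℝ (fun y => F (c + a • y)) univ := fun y _ =>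
    (hF _ (mem_univ _)).comp_of_eq (by fun_prop : AnalyticAt ℝ (fun y => c + a • y) y) rfl
  have hA : ∀ᵐ y ∂μ, F (c + a • y) ≠ 0 := hlin.ae_ne_zero μ ⟨x, hFx⟩
  have hQ : AnalyticOnNhd ℝ (fun y => F (c + a • (ρ / ‖y‖) • y)) {0}ᶜ := fun y hy =>
    (hlin ((ρ / ‖y‖) • y) (mem_univ _)).comp_of_eq (analyticAt_div_norm_smul ρ hy) rfl
  have hx0 : x ≠ 0 := by rw [← norm_pos_iff, hx]; exact hρ
  have hB := hQ.measure_inter_zero_of_isPreconnected μ isOpen_compl_singleton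
    (isConnected_compl_singleton_of_one_lt_rank hE 0).isPreconnected
    ⟨x, hx0, by simpa [hx, hρ.ne'] using hFx⟩
  filter_upwards [hA, compl_mem_ae_iff.2 hB] with y h1 h2
  rw [ballProj]
  split_ifs with hy
  · exact h1
  · intro h3
    refine h2 ⟨fun h0 => hy ?_, h3⟩
    simp only [mem_singleton_iff] at h0
    simp [h0, hρ.le]

/-- Freezing the second point at the witness `y` handles almost every first point; for each of
these, `y` is in turn a witness for the second variable. -/
theorem ae_ae_ballProj_ne_zero (μ : Measure E) [μ.IsAddHaarMeasure] (hE : 1 < Module.rank ℝ E)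
    {F : E → ℝ} (hF : AnalyticOnNhd ℝ F univ) (hne : ∃ x, F x ≠ 0) (c : E) {a₁ a₂ ρ : ℝ}
    (h₁ : 0 < a₁) (h₂ : 0 < a₂) (hρ : 0 < ρ) :
    ∀ᵐ y ∂μ, ∀ᵐ y' ∂μ, F (c + a₁ • ballProj ρ y + a₂ • ballProj ρ y') ≠ 0 := by
  obtain ⟨x, y, hx, hy, hxy⟩ := exists_sphere_add_sphere_ne_zero hE hF hne c
    (mul_pos h₁ hρ) (mul_pos h₂ hρ)
  have h3 := ae_ballProj_ne_zero μ hE hF (c + y) hρ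
    ⟨a₁⁻¹ • x, by rw [norm_smul, hx, norm_inv, Real.norm_eq_abs, abs_of_pos h₁]; field_simp,
      by rw [smul_smul, mul_inv_cancel₀ h₁.ne', one_smul, add_right_comm]; exact hxy⟩
  filter_upwards [h3] with z hz
  refine ae_ballProj_ne_zero μ hE hF _ hρ
    ⟨a₂⁻¹ • y, by rw [norm_smul, hy, norm_inv, Real.norm_eq_abs, abs_of_pos h₂]; field_simp, ?_⟩
  rwa [smul_smul, mul_inv_cancel₀ h₂.ne', one_smul, add_right_comm]

end Sphere

/-! ### Analyticity and measurability tools. -/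

theorem AnalyticAt.matrix_det {E ι : Type*} [NormedAddCommGroup E] [NormedSpace ℝ E] [Fintype ι]
    [DecidableEq ι] {M : E → Matrix ι ι ℝ} {x : E} (hM : ∀ i j, AnalyticAt ℝ (fun y => M y i j) x) :
    AnalyticAt ℝ (fun y => (M y).det) x := by
  simp only [Matrix.det_apply']
  exact Finset.analyticAt_fun_sum _ fun σ _ => analyticAt_const.mul
    (Finset.analyticAt_fun_prod _ fun i _ => hM _ _)

theorem Measurable.matrix_det {α ι : Type*} [MeasurableSpace α] [Fintype ι]
    [DecidableEq ι] {M : α → Matrix ι ι ℝ} (hM : ∀ i j, Measurable (fun y => M y i j)) :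
    Measurable (fun y => (M y).det) := by
  simp only [Matrix.det_apply']
  fun_prop

theorem measurable_euclideanSpace {α ι : Type*} [MeasurableSpace α] [Fintype ι]
    {f : α → EuclideanSpace ℝ ι} (hf : ∀ i, Measurable fun a => f a i) : Measurable f :=
  (MeasurableEquiv.toLp 2 (ι → ℝ)).measurable.comp (measurable_pi_iff.2 hf)

theorem measurable_ballProj {E : Type*} [NormedAddCommGroup E] [InnerProductSpace ℝ E]
    [FiniteDimensional ℝ E] [MeasurableSpace E] [BorelSpace E] (ρ : ℝ) :
    Measurable (ballProj ρ : E → E) := by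
  unfold ballProj
  exact Measurable.ite (measurableSet_le measurable_norm measurable_const) measurable_id
    ((measurable_const.div measurable_norm).smul measurable_id)

/-! ### Explicit gradients and prox-mappings. -/

namespace TwoLayer

variable {d N n : ℕ}

theorem measurable_matrix {α : Type*} [MeasurableSpace α] {M : α → Matrix (Fin d) (Fin d) ℝ} :
    Measurable M ↔ ∀ i j, Measurable fun a => M a i j := by
  refine ⟨fun hM i j => ?_, fun hM => ?_⟩
  · exact measurable_pi_iff.1 (measurable_pi_iff.1 (show Measurable (β := Fin d → Fin d → ℝ) M
      from hM) i) j
  · exact (measurable_pi_iff.2 fun i => measurable_pi_iff.2 fun j => hM i j :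
      Measurable (β := Fin d → Fin d → ℝ) M)

theorem gradTheta_apply (h : ℝ → ℝ) (u : Fin N → Fin d → ℝ) (v : Fin N → ℝ)
    (W : Matrix (Fin d) (Fin d) ℝ) (θ : EuclideanSpace ℝ (Fin d)) (j : Fin d) :
    gradTheta h u v W θ j = 1 / (2 * (N : ℝ)) *
      ∑ i, -(2 * (v i - network h W θ (u i)) * h ((W *ᵥ u i) j)) := by
  let L : Fin N → EuclideanSpace ℝ (Fin d) →L[ℝ] ℝ := fun i =>
    ∑ j, h ((W *ᵥ u i) j) • (EuclideanSpace.proj j : EuclideanSpace ℝ (Fin d) →L[ℝ] ℝ)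
  have hL : ∀ i θ, network h W θ (u i) = L i θ := by
    intro i θ
    simp [L, network, mul_comm]
  have hd : HasFDerivAt (fun θ' => loss h u v W θ') ((1 / (2 * (N : ℝ))) •
      ∑ i, (2 * (v i - L i θ)) • (-(L i))) θ := by
    simp only [loss, hL]
    refine (HasFDerivAt.fun_sum fun i _ => ?_).const_mul _
    convert! ((L i).hasFDerivAt (x := θ) |>.const_sub (v i)).pow 2 using 1
    simp
  have hsingle : ∀ i, L i (EuclideanSpace.single j 1) = h ((W *ᵥ u i) j) := by
    intro i
    simp [L, PiLp.single_apply]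
  have h1 : gradTheta h u v W θ j =
      ⟪gradTheta h u v W θ, EuclideanSpace.single j (1 : ℝ)⟫_ℝ := by
    rw [EuclideanSpace.inner_single_right]; simp
  rw [h1, gradTheta, gradient, InnerProductSpace.toDual_symm_apply, hd.fderiv]
  simp [hsingle, hL]

theorem gradW_apply {h : ℝ → ℝ} (hh : Differentiable ℝ h) (u : Fin N → Fin d → ℝ) (v : Fin N → ℝ)
    (W : Matrix (Fin d) (Fin d) ℝ) (θ : EuclideanSpace ℝ (Fin d)) (j k : Fin d) :
    gradW h u v W θ j k = 1 / (2 * (N : ℝ)) *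
      ∑ i, -(2 * (v i - network h W θ (u i)) * (θ j * (deriv h ((W *ᵥ u i) j) * u i k))) := by
  have hline : ∀ (t : ℝ) (i : Fin N) (l : Fin d), ((W + t • Matrix.single j k 1) *ᵥ u i) l =
      (W *ᵥ u i) l + t * (if l = j then u i k else 0) := by
    intro t i l
    rw [Matrix.add_mulVec, Matrix.smul_mulVec, Pi.add_apply, Pi.smul_apply,
      Matrix.single_mulVec]
    simp [Function.update_apply]
  have hnet : ∀ i, HasDerivAt (fun t : ℝ => network h (W + t • Matrix.single j k 1) θ (u i))
      (θ j * (deriv h ((W *ᵥ u i) j) * u i k)) 0 := by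
    intro i
    simp only [network, hline]
    have h1 : ∀ l ∈ Finset.univ, HasDerivAt (fun t : ℝ => θ l * h ((W *ᵥ u i) l + t *
        (if l = j then u i k else 0))) (θ l * (deriv h ((W *ᵥ u i) l) *
        (if l = j then u i k else 0))) 0 := by
      intro l _
      have h2 : HasDerivAt (fun t : ℝ => (W *ᵥ u i) l + t * (if l = j then u i k else 0))
          (if l = j then u i k else 0) 0 := by
        simpa using ((hasDerivAt_id (0 : ℝ)).mul_const (if l = j then u i k else 0)).const_add
          ((W *ᵥ u i) l)
      have h3 := (hh ((W *ᵥ u i) l)).hasDerivAt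
      exact (HasDerivAt.comp_of_eq (0 : ℝ) h3 h2 (by simp)).const_mul (θ l)
    convert! HasDerivAt.fun_sum h1 using 1
    simp
  have hd : HasDerivAt (fun t : ℝ => loss h u v (W + t • Matrix.single j k 1) θ)
      (1 / (2 * (N : ℝ)) *
      ∑ i, -(2 * (v i - network h W θ (u i)) * (θ j * (deriv h ((W *ᵥ u i) j) * u i k)))) 0 := by
    simp only [loss]
    refine (HasDerivAt.fun_sum fun i _ => ?_).const_mul _
    convert! ((hnet i).const_sub (v i)).pow 2 using 1
    simp
  rw [gradW, Matrix.of_apply, hd.deriv]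

theorem gradW_zero {h : ℝ → ℝ} (hh : Differentiable ℝ h) (u : Fin N → Fin d → ℝ) (v : Fin N → ℝ)
    (W : Matrix (Fin d) (Fin d) ℝ) : gradW h u v W 0 = 0 := by
  ext j k
  simp [gradW_apply hh]

theorem analyticOnNhd_det_step {h : ℝ → ℝ} (hh : Differentiable ℝ h) (u : Fin N → Fin d → ℝ)
    (v : Fin N → ℝ) (W : Matrix (Fin d) (Fin d) ℝ) (c : ℝ) :
    AnalyticOnNhd ℝ (fun θ => (W - c • gradW h u v W θ).det) univ := by
  intro θ _
  have hcoord : ∀ l, AnalyticAt ℝ (fun θ : EuclideanSpace ℝ (Fin d) => θ l) θ := fun l =>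
    (EuclideanSpace.proj (𝕜 := ℝ) l).analyticAt θ
  refine AnalyticAt.matrix_det fun j k => ?_
  simp only [Matrix.sub_apply, Matrix.smul_apply, smul_eq_mul, gradW_apply hh, network]
  refine analyticAt_const.sub (analyticAt_const.mul (analyticAt_const.mul
    (Finset.analyticAt_fun_sum _ fun i _ => ((analyticAt_const.mul (analyticAt_const.sub
      (Finset.analyticAt_fun_sum _ fun l _ => (hcoord l).mul analyticAt_const))).mul
      ((hcoord j).mul analyticAt_const)).neg)))

theorem measurable_network {α : Type*} [MeasurableSpace α] {h : ℝ → ℝ} (hh : Measurable h)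
    {W : α → Matrix (Fin d) (Fin d) ℝ} {θ : α → EuclideanSpace ℝ (Fin d)} (hW : Measurable W)
    (hθ : Measurable θ) (x : Fin d → ℝ) : Measurable fun a => network h (W a) (θ a) x := by
  have := measurable_matrix.1 hW
  simp only [network, Matrix.mulVec, dotProduct]
  fun_prop

theorem measurable_gradTheta {α : Type*} [MeasurableSpace α] {h : ℝ → ℝ} (hh : Measurable h)
    (u : Fin N → Fin d → ℝ) (v : Fin N → ℝ)
    {W : α → Matrix (Fin d) (Fin d) ℝ} {θ : α → EuclideanSpace ℝ (Fin d)} (hW : Measurable W)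
    (hθ : Measurable θ) : Measurable fun a => gradTheta h u v (W a) (θ a) := by
  refine measurable_euclideanSpace fun j => ?_
  have h1 := measurable_matrix.1 hW
  have h2 := measurable_network hh hW hθ
  simp only [gradTheta_apply, Matrix.mulVec, dotProduct]
  fun_prop

theorem measurable_gradW {α : Type*} [MeasurableSpace α] {h : ℝ → ℝ} (hh : Differentiable ℝ h)
    (u : Fin N → Fin d → ℝ) (v : Fin N → ℝ)
    {W : α → Matrix (Fin d) (Fin d) ℝ} {θ : α → EuclideanSpace ℝ (Fin d)} (hW : Measurable W)
    (hθ : Measurable θ) : Measurable fun a => gradW h u v (W a) (θ a) := by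
  refine measurable_matrix.2 fun j k => ?_
  have h1 := measurable_matrix.1 hW
  have h2 := measurable_network hh.continuous.measurable hW hθ
  have h3 := measurable_deriv h
  simp only [gradW_apply hh, Matrix.mulVec, dotProduct]
  fun_prop

/-- Completing the square turns the prox objective into half the squared distance to `x - y`, up to
a constant. Uniqueness is needed because `prox` is a choice among minimizers. -/
theorem prox_eq {K : Set (EuclideanSpace ℝ (Fin d))} {x y p : EuclideanSpace ℝ (Fin d)}
    (hp : p ∈ K) (hmin : ∀ z ∈ K, ‖p - (x - y)‖ ≤ ‖z - (x - y)‖)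
    (huniq : ∀ z ∈ K, ‖z - (x - y)‖ ≤ ‖p - (x - y)‖ → z = p) : prox K x y = p := by
  have hsq : ∀ z : EuclideanSpace ℝ (Fin d), ⟪y, z - x⟫_ℝ + 1 / 2 * ‖z - x‖ ^ 2 =
      1 / 2 * ‖z - (x - y)‖ ^ 2 - 1 / 2 * ‖y‖ ^ 2 := by
    intro z
    have : z - (x - y) = (z - x) + y := by abel
    rw [this, norm_add_sq_real, real_inner_comm]
    ring
  have hspec : prox K x y ∈ K ∧
      IsMinOn (fun z' => ⟪y, z' - x⟫_ℝ + 1 / 2 * ‖z' - x‖ ^ 2) K (prox K x y) := by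
    refine Classical.epsilon_spec (p := fun z =>
      z ∈ K ∧ IsMinOn (fun z' => ⟪y, z' - x⟫_ℝ + 1 / 2 * ‖z' - x‖ ^ 2) K z)
      ⟨p, hp, isMinOn_iff.2 fun z hz => ?_⟩
    rw [hsq, hsq]
    have := pow_le_pow_left₀ (norm_nonneg _) (hmin z hz) 2
    linarith
  refine huniq _ hspec.1 ?_
  have h1 := isMinOn_iff.1 hspec.2 p hp
  rw [hsq, hsq] at h1
  exact (sq_le_sq₀ (norm_nonneg _) (norm_nonneg _)).1 (by linarith)

theorem prox_univ (x y : EuclideanSpace ℝ (Fin d)) : prox univ x y = x - y :=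
  prox_eq (mem_univ _) (by simp) (by
    intro z _ hz
    simpa [sub_eq_zero] using hz)

theorem prox_closedBall {ρ : ℝ} (hρ : 0 < ρ) (x y : EuclideanSpace ℝ (Fin d)) :
    prox (closedBall 0 ρ) x y = ballProj ρ (x - y) := by
  set w := x - y with hw
  rw [ballProj]
  split_ifs with h
  · refine prox_eq (by simpa using h) (by simp [hw]) ?_
    intro z _ hz
    rw [← hw] at hz
    simpa [sub_eq_zero] using hz
  · push Not at h
    have hw0 : 0 < ‖w‖ := hρ.trans h
    have hdist : ‖(ρ / ‖w‖) • w - w‖ = ‖w‖ - ρ := by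
      have : (ρ / ‖w‖) • w - w = (-(1 - ρ / ‖w‖)) • w := by rw [neg_smul, sub_smul, one_smul]; abel
      have h2 : 0 < 1 - ρ / ‖w‖ := by rw [sub_pos, div_lt_one hw0]; exact h
      rw [this, norm_smul, norm_neg, Real.norm_eq_abs, abs_of_pos h2]
      field_simp
    refine prox_eq ?_ ?_ ?_
    · rw [mem_closedBall_zero_iff, norm_smul, Real.norm_eq_abs, abs_of_pos (by positivity)]
      field_simp; rfl
    · intro z hz
      rw [← hw, hdist]
      rw [mem_closedBall_zero_iff] at hz
      have := norm_sub_norm_le w z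
      rw [norm_sub_rev w z] at this
      linarith
    · intro z hz hle
      rw [← hw, hdist] at hle
      rw [mem_closedBall_zero_iff] at hz
      have h1 := pow_le_pow_left₀ (norm_nonneg _) hle 2
      rw [norm_sub_sq_real] at h1
      -- Expanding with `t = ρ / ‖w‖` and the bound on `‖z - w‖` gives at most `(1 - t) * (‖z‖ ^ 2 -
      -- ρ ^ 2)`, which is nonpositive.
      have h2 : ‖z - (ρ / ‖w‖) • w‖ ^ 2 ≤ 0 := by
        rw [norm_sub_sq_real, inner_smul_right, norm_smul, Real.norm_eq_abs,
          abs_of_pos (by positivity), div_mul_cancel₀ _ hw0.ne']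
        set t := ρ / ‖w‖ with ht
        have htw : t * ‖w‖ = ρ := div_mul_cancel₀ _ hw0.ne'
        have ht0 : 0 < t := by positivity
        have ht1 : t < 1 := by rw [ht, div_lt_one hw0]; exact h
        have hzρ := pow_le_pow_left₀ (norm_nonneg _) hz 2
        have h3 : t * (2 * ⟪z, w⟫_ℝ) ≥ t * (‖z‖ ^ 2 + 2 * ρ * ‖w‖ - ρ ^ 2) :=
          mul_le_mul_of_nonneg_left (by nlinarith) ht0.le
        have h4 : t * (‖z‖ ^ 2 + 2 * ρ * ‖w‖ - ρ ^ 2) = t * ‖z‖ ^ 2 + 2 * ρ ^ 2 - t * ρ ^ 2 := by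
          linear_combination 2 * ρ * htw
        nlinarith [mul_nonneg (sub_nonneg.2 ht1.le) (sub_nonneg.2 hzρ)]
      have h3 : ‖z - (ρ / ‖w‖) • w‖ = 0 := by
        have := le_antisymm h2 (sq_nonneg _)
        exact pow_eq_zero_iff two_ne_zero |>.1 this
      exact sub_eq_zero.1 (norm_eq_zero.1 h3)

end TwoLayer

/-! ### The inner loop as a function of its last noise vectors. -/

theorem ae_pi_of_ae_snoc {n : ℕ} {α : Type*} [MeasureSpace α] [SigmaFinite (volume : Measure α)]
    {q : (Fin (n + 1) → α) → Prop} (hq : MeasurableSet {z | q z})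
    (h : ∀ᵐ z : Fin n → α, ∀ᵐ y : α, q (Fin.snoc (α := fun _ => α) z y)) : ∀ᵐ z, q z := by
  have he := volume_preserving_piFinSuccAbove (fun _ : Fin (n + 1) => α) (Fin.last n)
  set e := MeasurableEquiv.piFinSuccAbove (fun _ : Fin (n + 1) => α) (Fin.last n) with he_def
  have hsw := (Measure.measurePreserving_swap (μ := (volume : Measure α))
    (ν := (volume : Measure (Fin n → α)))).comp he
  have hsnoc : ∀ p : (Fin n → α) × α, e.symm p.swap = Fin.snoc (α := fun _ => α) p.1 p.2 := by
    intro p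
    exact Fin.insertNth_last' (β := α) p.2 p.1
  have hm : MeasurableSet {p : (Fin n → α) × α | q (e.symm p.swap)} :=
    (e.symm.measurable.comp measurable_swap) hq
  have h2 : ∀ᵐ p ∂((volume : Measure (Fin n → α)).prod (volume : Measure α)),
      q (e.symm p.swap) := by
    rw [Measure.ae_prod_iff_ae_ae hm]
    simpa only [hsnoc] using h
  filter_upwards [hsw.quasiMeasurePreserving.ae h2] with z hz
  simpa using hz

namespace TwoLayer

variable {d N n : ℕ} {h : ℝ → ℝ} {u : Fin N → Fin d → ℝ} {v : Fin N → ℝ}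
  {K : Set (EuclideanSpace ℝ (Fin d))}

theorem measurable_prox (hK : K = univ ∨ ∃ ρ : ℝ, 0 < ρ ∧ K = closedBall 0 ρ) {α : Type*}
    [MeasurableSpace α] {x y : α → EuclideanSpace ℝ (Fin d)} (hx : Measurable x)
    (hy : Measurable y) : Measurable fun a => prox K (x a) (y a) := by
  rcases hK with rfl | ⟨ρ, hρ, rfl⟩
  · simp only [prox_univ]
    exact hx.sub hy
  · simp only [prox_closedBall hρ]
    exact (measurable_ballProj ρ).comp (hx.sub hy)

theorem innerIter_succ (β : Fin n → ℝ) (W : Matrix (Fin d) (Fin d) ℝ)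
    (θ : EuclideanSpace ℝ (Fin d)) (z : Fin n → EuclideanSpace ℝ (Fin d)) (i : Fin n) :
    innerIter h u v K β W θ z i.succ = prox K (innerIter h u v K β W θ z i.castSucc)
      (β i • (gradTheta h u v W (innerIter h u v K β W θ z i.castSucc) + z i)) := rfl

/-- The last noise vector affects only the last iterate. -/
theorem innerIter_snoc_castSucc (β : Fin (n + 1) → ℝ) (W : Matrix (Fin d) (Fin d) ℝ)
    (θ : EuclideanSpace ℝ (Fin d)) (z : Fin n → EuclideanSpace ℝ (Fin d))
    (y : EuclideanSpace ℝ (Fin d)) (i : Fin (n + 1)) :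
    innerIter h u v K β W θ (Fin.snoc (α := fun _ => EuclideanSpace ℝ (Fin d)) z y) i.castSucc =
      innerIter h u v K (fun j => β j.castSucc) W θ z i := by
  induction i using Fin.induction with
  | zero => rfl
  | succ i ih =>
    rw [← Fin.succ_castSucc, innerIter_succ, innerIter_succ, ih, Fin.snoc_castSucc]

theorem innerAvg_snoc (β : Fin (n + 1) → ℝ) (W : Matrix (Fin d) (Fin d) ℝ)
    (θ : EuclideanSpace ℝ (Fin d)) (z : Fin n → EuclideanSpace ℝ (Fin d))
    (y : EuclideanSpace ℝ (Fin d)) :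
    innerAvg h u v K β W θ (Fin.snoc (α := fun _ => EuclideanSpace ℝ (Fin d)) z y) =
      (∑ τ, β τ)⁻¹ • (∑ τ : Fin n, β τ.castSucc •
          innerIter h u v K (fun j => β j.castSucc) W θ z τ.succ +
        β (Fin.last n) • prox K (innerIter h u v K (fun j => β j.castSucc) W θ z (Fin.last n))
          (β (Fin.last n) • (gradTheta h u v W
            (innerIter h u v K (fun j => β j.castSucc) W θ z (Fin.last n)) + y))) := by
  rw [innerAvg, Fin.sum_univ_castSucc (n := n) (fun τ => β τ • innerIter h u v K β W θ _ τ.succ)]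
  simp only [innerIter_succ _ _ _ _ (Fin.last n), Fin.succ_castSucc, innerIter_snoc_castSucc,
    Fin.snoc_last]

theorem measurable_innerIter (hh : Measurable h)
    (hK : K = univ ∨ ∃ ρ : ℝ, 0 < ρ ∧ K = closedBall 0 ρ) (β : Fin n → ℝ)
    {α : Type*} [MeasurableSpace α] {W : α → Matrix (Fin d) (Fin d) ℝ}
    {θ : α → EuclideanSpace ℝ (Fin d)} {z : α → Fin n → EuclideanSpace ℝ (Fin d)}
    (hW : Measurable W) (hθ : Measurable θ) (hz : Measurable z) (i : Fin (n + 1)) :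
    Measurable fun a => innerIter h u v K β (W a) (θ a) (z a) i := by
  induction i using Fin.induction with
  | zero => exact hθ
  | succ i ih =>
    simp only [innerIter_succ]
    exact measurable_prox hK ih (((measurable_gradTheta hh u v hW ih).add
      ((measurable_pi_apply i).comp hz)).const_smul (β i))

theorem measurable_innerAvg (hh : Measurable h)
    (hK : K = univ ∨ ∃ ρ : ℝ, 0 < ρ ∧ K = closedBall 0 ρ) (β : Fin n → ℝ)
    {α : Type*} [MeasurableSpace α] {W : α → Matrix (Fin d) (Fin d) ℝ}
    {θ : α → EuclideanSpace ℝ (Fin d)} {z : α → Fin n → EuclideanSpace ℝ (Fin d)}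
    (hW : Measurable W) (hθ : Measurable θ) (hz : Measurable z) :
    Measurable fun a => innerAvg h u v K β (W a) (θ a) (z a) := by
  have := measurable_innerIter (u := u) (v := v) hh hK β hW hθ hz
  simp only [innerAvg]
  fun_prop

theorem ae_innerAvg_univ_ne_zero {F : EuclideanSpace ℝ (Fin d) → ℝ} (hF : AnalyticOnNhd ℝ F univ)
    (hne : ∃ x, F x ≠ 0) (hh : Measurable h) (hn : 1 ≤ n) {β : Fin n → ℝ} (hβ : ∀ i, 0 < β i)
    (W : Matrix (Fin d) (Fin d) ℝ) (θ : EuclideanSpace ℝ (Fin d)) :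
    ∀ᵐ z : Fin n → EuclideanSpace ℝ (Fin d), F (innerAvg h u v univ β W θ z) ≠ 0 := by
  obtain ⟨n, rfl⟩ := Nat.exists_eq_add_of_le' hn
  have hFm : Measurable F := (continuousOn_univ.1 hF.continuousOn).measurable
  refine ae_pi_of_ae_snoc ?_ (ae_of_all _ fun z => ?_)
  · exact (hFm.comp (measurable_innerAvg hh (Or.inl rfl) β measurable_const measurable_const
      measurable_id)) (measurableSet_singleton (0 : ℝ)).compl
  have hS : 0 < ∑ τ, β τ := Finset.sum_pos (fun i _ => hβ i) Finset.univ_nonempty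
  simp only [innerAvg_snoc, prox_univ]
  set x := innerIter h u v univ (fun j => β j.castSucc) W θ z (Fin.last n)
  set b := β (Fin.last n)
  have hb : 0 < b := hβ _
  filter_upwards [ae_sub_smul volume (hF.ae_ne_zero volume hne)
    ((∑ τ, β τ)⁻¹ • (∑ τ : Fin n, β τ.castSucc •
      innerIter h u v univ (fun j => β j.castSucc) W θ z τ.succ +
      b • (x - b • gradTheta h u v W x)))
    -- The step size occurs twice: once scaling the noise, once as the weight in the average.
    (show (∑ τ, β τ)⁻¹ * (b * b) ≠ 0 by positivity)] with y hy
  convert hy using 2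
  module

theorem ae_innerAvg_closedBall_ne_zero {F : EuclideanSpace ℝ (Fin d) → ℝ}
    (hF : AnalyticOnNhd ℝ F univ) (hne : ∃ x, F x ≠ 0) (hh : Measurable h) (hd : 2 ≤ d)
    (hn : 2 ≤ n) {ρ : ℝ} (hρ : 0 < ρ) {β : Fin n → ℝ} (hβ : ∀ i, 0 < β i)
    (W : Matrix (Fin d) (Fin d) ℝ) (θ : EuclideanSpace ℝ (Fin d)) :
    ∀ᵐ z : Fin n → EuclideanSpace ℝ (Fin d),
      F (innerAvg h u v (closedBall 0 ρ) β W θ z) ≠ 0 := by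
  obtain ⟨n, rfl⟩ := Nat.exists_eq_add_of_le' hn
  have hFm : Measurable F := (continuousOn_univ.1 hF.continuousOn).measurable
  have hrank : 1 < Module.rank ℝ (EuclideanSpace ℝ (Fin d)) := by
    rw [← Module.finrank_eq_rank, finrank_euclideanSpace_fin]
    exact_mod_cast hd
  set S := ∑ τ, β τ with hS_def
  have hS : 0 < S := Finset.sum_pos (fun i _ => hβ i) Finset.univ_nonempty
  set b := β (Fin.last (n + 1)) with hb_def
  have hb : 0 < b := hβ _
  set b' := β (Fin.last n).castSucc with hb'_def
  have hb' : 0 < b' := hβ _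
  let f : (Fin (n + 1) → EuclideanSpace ℝ (Fin d)) → EuclideanSpace ℝ (Fin d) → ℝ := fun z y =>
    F (innerAvg h u v (closedBall 0 ρ) β W θ
      (Fin.snoc (α := fun _ => EuclideanSpace ℝ (Fin d)) z y))
  have hm : Measurable fun z : Fin (n + 2) → EuclideanSpace ℝ (Fin d) =>
      F (innerAvg h u v (closedBall 0 ρ) β W θ z) :=
    hFm.comp (measurable_innerAvg hh (Or.inr ⟨ρ, hρ, rfl⟩) β measurable_const measurable_const
      measurable_id)
  have hsm : Measurable fun p : (Fin (n + 1) → EuclideanSpace ℝ (Fin d)) ×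
      EuclideanSpace ℝ (Fin d) =>
      (Fin.snoc (α := fun _ => EuclideanSpace ℝ (Fin d)) p.1 p.2 :
        Fin (n + 2) → EuclideanSpace ℝ (Fin d)) := by
    refine measurable_pi_iff.2 fun i => ?_
    induction i using Fin.lastCases with
    | last => simpa using measurable_snd
    | cast i => simpa [Function.comp_def] using (measurable_pi_apply i).comp measurable_fst
  refine ae_pi_of_ae_snoc (hm (measurableSet_singleton (0 : ℝ)).compl) (ae_pi_of_ae_snoc ?_
    (ae_of_all _ fun z => ?_))
  · have h1 : MeasurableSet {p : (Fin (n + 1) → EuclideanSpace ℝ (Fin d)) ×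
        EuclideanSpace ℝ (Fin d) | f p.1 p.2 = 0} :=
      (hm.comp hsm) (measurableSet_singleton (0 : ℝ))
    simp only [ae_iff, ne_eq, not_not]
    exact (measurable_measure_prodMk_left (ν := volume) h1) (measurableSet_singleton 0)
  set β' : Fin n → ℝ := fun j => β j.castSucc.castSucc with hβ'
  set x := innerIter h u v (closedBall 0 ρ) β' W θ z (Fin.last n)
  set T := ∑ τ : Fin n, β' τ • innerIter h u v (closedBall 0 ρ) β' W θ z τ.succ
  have hkey : ∀ᵐ y, ∀ᵐ y', F (S⁻¹ • T + (S⁻¹ * b') • ballProj ρ y + (S⁻¹ * b) • ballProj ρ y') ≠ 0 :=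
    ae_ae_ballProj_ne_zero volume hrank hF hne _ (by positivity) (by positivity) hρ
  filter_upwards [ae_sub_smul volume hkey (x - b' • gradTheta h u v W x) hb'.ne'] with y hy
  have hprox : ∀ (c : ℝ) (a y : EuclideanSpace ℝ (Fin d)), prox (closedBall 0 ρ) a
      (c • (gradTheta h u v W a + y)) = ballProj ρ (a - c • gradTheta h u v W a - c • y) := by
    intro c a y
    rw [prox_closedBall hρ]
    congr 1
    module
  set x₁ := ballProj ρ (x - b' • gradTheta h u v W x - b' • y) with hx₁
  -- The shift depends on `y` through `x₁`, which is harmless because `y` is already fixed.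
  filter_upwards [ae_sub_smul volume hy (x₁ - b • gradTheta h u v W x₁) hb.ne'] with y' hy'
  have hlast : innerIter h u v (closedBall 0 ρ) (fun j => β j.castSucc) W θ
      (Fin.snoc (α := fun _ => EuclideanSpace ℝ (Fin d)) z y) (Fin.last (n + 1)) = x₁ := by
    rw [← Fin.succ_last, innerIter_succ, innerIter_snoc_castSucc, hprox, Fin.snoc_last]
  have hlast' := hlast
  rw [← Fin.succ_last] at hlast'
  rw [innerAvg_snoc, hlast, hprox, Fin.sum_univ_castSucc (n := n) (fun τ => β τ.castSucc • innerIter h u v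
    (closedBall 0 ρ) (fun j => β j.castSucc) W θ (Fin.snoc (α := fun _ =>
      EuclideanSpace ℝ (Fin d)) z y) τ.succ), hlast']
  simp only [Fin.succ_castSucc, innerIter_snoc_castSucc]
  convert hy' using 2
  module

end TwoLayer

/-! ### Absolute continuity and independence of the noise. -/

theorem MeasureTheory.Measure.AbsolutelyContinuous.pi_fin {n : ℕ} {α : Type*} [MeasurableSpace α]
    {μ ν : Fin n → Measure α} [∀ i, SigmaFinite (μ i)] [∀ i, SigmaFinite (ν i)]
    (h : ∀ i, μ i ≪ ν i) : Measure.pi μ ≪ Measure.pi ν := by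
  induction n with
  | zero =>
    rw [Subsingleton.elim μ ν]
  | succ n ih =>
    have h1 := measurePreserving_piFinSuccAbove μ 0
    have h2 := measurePreserving_piFinSuccAbove ν 0
    have h3 := (h 0).prod (ih (μ := fun j => μ (Fin.succAbove 0 j))
      (ν := fun j => ν (Fin.succAbove 0 j)) fun j => h _)
    rw [← (h1.symm _).map_eq, ← (h2.symm _).map_eq]
    exact h3.map (MeasurableEquiv.measurable _)

theorem ProbabilityTheory.IndepFun.prodMk_of_prodMk {Ω α β γ : Type*} [MeasurableSpace Ω]
    [MeasurableSpace α] [MeasurableSpace β] [MeasurableSpace γ] {μ : Measure Ω}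
    [IsFiniteMeasure μ] {A : Ω → α} {B : Ω → β} {C : Ω → γ} (hA : Measurable A) (hB : Measurable B)
    (hC : Measurable C) (hABC : IndepFun A (fun ω => (B ω, C ω)) μ) (hBC : IndepFun B C μ) :
    IndepFun (fun ω => (A ω, B ω)) C μ := by
  have hAB : IndepFun A B μ := hABC.comp measurable_id measurable_fst
  rw [indepFun_iff_map_prod_eq_prod_map_map (by fun_prop) (by fun_prop)] at *
  have h1 : μ.map (fun ω => ((A ω, B ω), C ω)) =
      (μ.map (fun ω => (A ω, B ω, C ω))).map MeasurableEquiv.prodAssoc.symm := by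
    rw [Measure.map_map (by fun_prop) (by fun_prop)]
    rfl
  rw [h1, hABC, hBC, hAB]
  exact ((measurePreserving_prodAssoc _ _ _).symm _).map_eq

/-- Independence makes the joint law of the coordinates a product of absolutely continuous laws;
regrouping them into vectors is a linear isomorphism, which carries Lebesgue measure to a Haar
measure. -/
theorem absolutelyContinuous_map_euclideanSpace {Ω : Type*} [MeasurableSpace Ω] {μ : Measure Ω}
    {n d : ℕ} {X : Fin n → Ω → EuclideanSpace ℝ (Fin d)} (hX : ∀ i, Measurable (X i))
    (hindep : iIndepFun (fun (p : Fin n × Fin d) ω => X p.1 ω p.2) μ)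
    (hac : ∀ i j, μ.map (fun ω => X i ω j) ≪ (volume : Measure ℝ)) :
    μ.map (fun ω i => X i ω) ≪ volume := by
  have := hindep.isProbabilityMeasure
  let e : Fin (n * d) ≃ Fin n × Fin d := finProdFinEquiv.symm
  let Y : Fin (n * d) → Ω → ℝ := fun q ω => X (e q).1 ω (e q).2
  have hXc : ∀ i j, Measurable fun ω => X i ω j := fun i j => by fun_prop
  have hY : iIndepFun Y μ := hindep.precomp (g := e) e.injective
  have hYm : ∀ q, Measurable (Y q) := fun q => hXc _ _
  have hlaw := hY.map_fun_eq_pi_map fun q => (hYm q).aemeasurable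
  have : ∀ q, IsProbabilityMeasure (μ.map (Y q)) := fun q =>
    Measure.isProbabilityMeasure_map (hYm q).aemeasurable
  have hYac : μ.map (fun ω q => Y q ω) ≪ (volume : Measure (Fin (n * d) → ℝ)) := by
    rw [hlaw]
    exact Measure.AbsolutelyContinuous.pi_fin fun q => hac _ _
  let L : (Fin (n * d) → ℝ) ≃ₗ[ℝ] (Fin n → EuclideanSpace ℝ (Fin d)) :=
    (LinearEquiv.funCongrLeft ℝ ℝ e.symm).trans ((LinearEquiv.curry ℝ ℝ (Fin n) (Fin d)).trans
      (LinearEquiv.piCongrRight fun _ => (WithLp.linearEquiv 2 ℝ (Fin d → ℝ)).symm))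
  let L' := L.toContinuousLinearEquiv
  have hL : (fun ω i => X i ω) = L' ∘ fun ω q => Y q ω := by
    funext ω i
    ext j
    simp [L', L, Y, LinearEquiv.funCongrLeft, LinearMap.funLeft]
  rw [hL, ← Measure.map_map L'.continuous.measurable (measurable_pi_iff.2 hYm)]
  refine (hYac.map L'.continuous.measurable).trans ?_
  have : ((volume : Measure (Fin (n * d) → ℝ)).map L').IsAddHaarMeasure := inferInstance
  exact Measure.absolutelyContinuous_isAddHaarMeasure _ _

theorem indepFun_past_present {Ω : Type*} [MeasurableSpace Ω] {μ : Measure Ω}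
    {n d : ℕ} {ξ : ℕ → Fin n → Ω → EuclideanSpace ℝ (Fin d)} (hξ : ∀ k i, Measurable (ξ k i))
    (hindep : iIndepFun (fun (p : ℕ × Fin n × Fin d) ω => ξ p.1 p.2.1 ω p.2.2) μ) (k : ℕ) :
    IndepFun (fun ω (j : Fin k) i => ξ j i ω) (fun ω i => ξ k i ω) μ := by
  classical
  let S : Finset (ℕ × Fin n × Fin d) := Finset.range k ×ˢ Finset.univ
  let T : Finset (ℕ × Fin n × Fin d) := {k} ×ˢ Finset.univ
  have hST : Disjoint S T := by
    rw [Finset.disjoint_left]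
    rintro ⟨a, b⟩ h1 h2
    simp only [S, T, Finset.mem_product, Finset.mem_range, Finset.mem_singleton] at h1 h2
    omega
  have hm : ∀ p : ℕ × Fin n × Fin d, Measurable fun ω => ξ p.1 p.2.1 ω p.2.2 := fun p => by
    have := hξ p.1 p.2.1
    fun_prop
  have h := hindep.indepFun_finset S T hST hm
  have hS : ∀ (j : Fin k) i c, ((j : ℕ), i, c) ∈ S := fun j i c => by simp [S]
  have hT : ∀ i c, (k, i, c) ∈ T := fun i c => by simp [T]
  let f : (S → ℝ) → Fin k → Fin n → EuclideanSpace ℝ (Fin d) := fun y j i =>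
    WithLp.toLp 2 fun c => y ⟨_, hS j i c⟩
  let g : (T → ℝ) → Fin n → EuclideanSpace ℝ (Fin d) := fun y i =>
    WithLp.toLp 2 fun c => y ⟨_, hT i c⟩
  have hf : Measurable f := measurable_pi_iff.2 fun j => measurable_pi_iff.2 fun i =>
    measurable_euclideanSpace fun c => measurable_pi_apply _
  have hg : Measurable g := measurable_pi_iff.2 fun i =>
    measurable_euclideanSpace fun c => measurable_pi_apply _
  exact h.comp hf hg

/-! ### Induction over the outer iterations. -/

namespace TwoLayer

variable {d N n : ℕ} {h : ℝ → ℝ} {u : Fin N → Fin d → ℝ} {v : Fin N → ℝ}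
  {K : Set (EuclideanSpace ℝ (Fin d))}

theorem measurable_sub_smul_gradW {α : Type*} [MeasurableSpace α] (hh : Differentiable ℝ h)
    {W : α → Matrix (Fin d) (Fin d) ℝ} {θ : α → EuclideanSpace ℝ (Fin d)} (hW : Measurable W)
    (hθ : Measurable θ) (c : ℝ) : Measurable fun a => W a - c • gradW h u v (W a) (θ a) := by
  have h1 := measurable_matrix.1 hW
  have h2 := measurable_matrix.1 (measurable_gradW hh u v hW hθ)
  refine measurable_matrix.2 fun i j => ?_
  simp only [Matrix.sub_apply, Matrix.smul_apply]
  fun_prop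

theorem measurable_sgdGd {α : Type*} [MeasurableSpace α] (hh : Differentiable ℝ h)
    (hK : K = univ ∨ ∃ ρ : ℝ, 0 < ρ ∧ K = closedBall 0 ρ) (β : ℕ → Fin n → ℝ) (γ : ℕ → ℝ)
    {W : α → Matrix (Fin d) (Fin d) ℝ} {θ : α → EuclideanSpace ℝ (Fin d)}
    {z : α → ℕ → Fin n → EuclideanSpace ℝ (Fin d)} (hW : Measurable W) (hθ : Measurable θ)
    (hz : Measurable z) (k : ℕ) :
    Measurable fun a => sgdGd h u v K β γ (W a) (θ a) (z a) k := by
  induction k with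
  | zero => exact hW.prodMk hθ
  | succ k ih =>
    have h1 := measurable_innerAvg (u := u) (v := v) hh.continuous.measurable hK (β k)
      (measurable_fst.comp ih) (measurable_snd.comp ih) ((measurable_pi_apply k).comp hz)
    exact (measurable_sub_smul_gradW hh (measurable_fst.comp ih) h1 (γ k)).prodMk h1

theorem sgdGd_congr (β : ℕ → Fin n → ℝ) (γ : ℕ → ℝ) (W : Matrix (Fin d) (Fin d) ℝ)
    (θ : EuclideanSpace ℝ (Fin d)) {z z' : ℕ → Fin n → EuclideanSpace ℝ (Fin d)} {k : ℕ}
    (hz : ∀ j < k, z j = z' j) : sgdGd h u v K β γ W θ z k = sgdGd h u v K β γ W θ z' k := by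
  induction k with
  | zero => rfl
  | succ k ih =>
    simp only [sgdGd]
    rw [ih fun j hj => hz j (hj.trans k.lt_succ_self), hz k k.lt_succ_self]

theorem singularEvent_eq {Ω : Type*} (β : ℕ → Fin n → ℝ) (γ : ℕ → ℝ)
    (W₀ : Ω → Matrix (Fin d) (Fin d) ℝ) (θ₀ : Ω → EuclideanSpace ℝ (Fin d))
    (ξ : ℕ → Fin n → Ω → EuclideanSpace ℝ (Fin d)) (k : ℕ) :
    singularEvent h u v K β γ W₀ θ₀ ξ k =
      {ω | (sgdGd h u v K β γ (W₀ ω) (θ₀ ω) (fun j i => ξ j i ω) k).1.det = 0} := by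
  ext ω
  exact Matrix.exists_mulVec_eq_zero_iff

/-- One outer iteration turns an invertible matrix into an invertible one, for almost every
realization of the noise of the inner loop. -/
theorem ae_det_step_ne_zero (hh : Differentiable ℝ h) (hn : 1 ≤ n)
    (hK : K = univ ∨ 2 ≤ d ∧ 2 ≤ n ∧ ∃ R : ℝ, 0 < R ∧ K = closedBall 0 (R / 2))
    {β : Fin n → ℝ} (hβ : ∀ i, 0 < β i) (c : ℝ) {W : Matrix (Fin d) (Fin d) ℝ}
    (hW : W.det ≠ 0) (θ : EuclideanSpace ℝ (Fin d)) :
    ∀ᵐ z : Fin n → EuclideanSpace ℝ (Fin d),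
      (W - c • gradW h u v W (innerAvg h u v K β W θ z)).det ≠ 0 := by
  have hF := analyticOnNhd_det_step hh u v W c
  -- At `θ = 0` the network is constant in `W`, so the step leaves `W` unchanged.
  have hne : ∃ θ, (W - c • gradW h u v W θ).det ≠ 0 := ⟨0, by simpa [gradW_zero hh] using hW⟩
  rcases hK with rfl | ⟨hd, hn2, R, hR, rfl⟩
  · exact ae_innerAvg_univ_ne_zero hF hne hh.continuous.measurable hn hβ W θ
  · exact ae_innerAvg_closedBall_ne_zero hF hne hh.continuous.measurable hd hn2 (half_pos hR) hβ W θ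

theorem ae_det_sgdGd_ne_zero {Ω : Type*} [MeasurableSpace Ω] {μ : Measure Ω}
    [IsProbabilityMeasure μ] (hh : Differentiable ℝ h) (hn : 1 ≤ n)
    (hK : K = univ ∨ 2 ≤ d ∧ 2 ≤ n ∧ ∃ R : ℝ, 0 < R ∧ K = closedBall 0 (R / 2))
    {β : ℕ → Fin n → ℝ} (hβ : ∀ k i, 0 < β k i) (γ : ℕ → ℝ)
    {W₀ : Ω → Matrix (Fin d) (Fin d) ℝ} {θ₀ : Ω → EuclideanSpace ℝ (Fin d)}
    (hW₀ : Measurable W₀) (hθ₀ : Measurable θ₀)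
    (hW₀_ac : μ.map (fun ω i j => W₀ ω i j) ≪ (volume : Measure (Fin d → Fin d → ℝ)))
    {ξ : ℕ → Fin n → Ω → EuclideanSpace ℝ (Fin d)} (hξ : ∀ k i, Measurable (ξ k i))
    (hξ_ac : ∀ k i j, μ.map (fun ω => ξ k i ω j) ≪ (volume : Measure ℝ))
    (hξ_indep : iIndepFun (fun (p : ℕ × Fin n × Fin d) ω => ξ p.1 p.2.1 ω p.2.2) μ)
    (hinit_indep : IndepFun (fun ω => (W₀ ω, θ₀ ω)) (fun ω k i => ξ k i ω) μ) (k : ℕ) :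
    ∀ᵐ ω ∂μ, (sgdGd h u v K β γ (W₀ ω) (θ₀ ω) (fun j i => ξ j i ω) k).1.det ≠ 0 := by
  have hK' : K = univ ∨ ∃ ρ : ℝ, 0 < ρ ∧ K = closedBall 0 ρ :=
    hK.imp_right fun ⟨_, _, R, hR, hKR⟩ => ⟨R / 2, half_pos hR, hKR⟩
  have hW₀c := measurable_matrix.1 hW₀
  induction k with
  | zero =>
    have han : AnalyticOnNhd ℝ (fun M : Fin d → Fin d → ℝ => (Matrix.of M).det) univ := fun M _ =>
      AnalyticAt.matrix_det fun i j =>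
        ((ContinuousLinearMap.proj (R := ℝ) (φ := fun _ : Fin d => ℝ) j).comp
          (ContinuousLinearMap.proj (R := ℝ) (φ := fun _ : Fin d => Fin d → ℝ) i)).analyticAt M
    have h1 := hW₀_ac.ae_le (han.ae_ne_zero volume ⟨(1 : Matrix (Fin d) (Fin d) ℝ), by
      change (1 : Matrix (Fin d) (Fin d) ℝ).det ≠ 0
      simp⟩)
    exact ae_of_ae_map (measurable_pi_iff.2 fun i => measurable_pi_iff.2 fun j =>
      hW₀c i j).aemeasurable h1
  | succ k ih =>
    let past : Ω → Fin k → Fin n → EuclideanSpace ℝ (Fin d) := fun ω j i => ξ j i ω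
    let now : Ω → Fin n → EuclideanSpace ℝ (Fin d) := fun ω i => ξ k i ω
    let S : Ω → Matrix (Fin d) (Fin d) ℝ × EuclideanSpace ℝ (Fin d) := fun ω =>
      sgdGd h u v K β γ (W₀ ω) (θ₀ ω) (fun j i => ξ j i ω) k
    have hpast : Measurable past := measurable_pi_iff.2 fun j => measurable_pi_iff.2 fun i => hξ _ _
    have hnow : Measurable now := measurable_pi_iff.2 fun i => hξ _ _
    have hS : Measurable S := measurable_sgdGd hh hK' β γ hW₀ hθ₀
      (measurable_pi_iff.2 fun j => measurable_pi_iff.2 fun i => hξ _ _) k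
    have hind : IndepFun (fun ω => ((W₀ ω, θ₀ ω), past ω)) now μ := by
      refine IndepFun.prodMk_of_prodMk (hW₀.prodMk hθ₀) hpast hnow ?_
        (indepFun_past_present hξ hξ_indep k)
      exact hinit_indep.comp measurable_id (ψ := fun z : ℕ → Fin n → EuclideanSpace ℝ (Fin d) =>
        ((fun j : Fin k => z j), z k)) (by fun_prop)
    -- Padding with zeros exhibits the state as a measurable function of the initialization and the
    -- first `k` noise blocks only, hence independent of the current block.
    let pastExt : (Fin k → Fin n → EuclideanSpace ℝ (Fin d)) →
        ℕ → Fin n → EuclideanSpace ℝ (Fin d) := fun w j => if hj : j < k then w ⟨j, hj⟩ else 0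
    have h_past_ext : Measurable pastExt := by
      refine measurable_pi_iff.2 fun j => ?_
      by_cases hj : j < k
      · simpa [pastExt, hj] using measurable_pi_apply _
      · simp [pastExt, hj]
    have hSind : IndepFun S now μ := by
      have h1 := hind.comp (φ := fun p => sgdGd h u v K β γ p.1.1 p.1.2 (pastExt p.2) k)
        (measurable_sgdGd hh hK' β γ (measurable_fst.comp measurable_fst)
          (measurable_snd.comp measurable_fst) (h_past_ext.comp measurable_snd) k) measurable_id
      refine h1.congr (ae_of_all _ fun ω => Eq.symm ?_) (ae_of_all _ fun ω => rfl)
      refine sgdGd_congr β γ _ _ fun j hj => ?_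
      simp [pastExt, hj, past]
    rw [indepFun_iff_map_prod_eq_prod_map_map hS.aemeasurable hnow.aemeasurable] at hSind
    have hnow_ac : μ.map now ≪ volume := absolutelyContinuous_map_euclideanSpace (hξ k)
      (hξ_indep.precomp (g := fun p : Fin n × Fin d => (k, p)) (Prod.mk_right_injective k))
      (hξ_ac k)
    let G : (Matrix (Fin d) (Fin d) ℝ × EuclideanSpace ℝ (Fin d)) ×
        (Fin n → EuclideanSpace ℝ (Fin d)) → ℝ := fun p =>
      (p.1.1 - γ k • gradW h u v p.1.1 (innerAvg h u v K (β k) p.1.1 p.1.2 p.2)).det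
    have hG : Measurable G := Measurable.matrix_det (measurable_matrix.1
      (measurable_sub_smul_gradW hh (by fun_prop) (measurable_innerAvg hh.continuous.measurable hK'
        (β k) (by fun_prop) (by fun_prop) (by fun_prop)) (γ k)))
    have hdet : Measurable fun p : Matrix (Fin d) (Fin d) ℝ × EuclideanSpace ℝ (Fin d) =>
      p.1.det := Measurable.matrix_det (measurable_matrix.1 measurable_fst)
    have hae : ∀ᵐ p ∂(μ.map fun ω => (S ω, now ω)), G p ≠ 0 := by
      have : IsProbabilityMeasure (μ.map now) :=
        Measure.isProbabilityMeasure_map hnow.aemeasurable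
      -- Under the product law the state can be frozen; the one-step result then applies to every
      -- state with invertible matrix.
      rw [hSind, Measure.ae_prod_iff_ae_ae (p := fun p => G p ≠ 0)
        (hG (measurableSet_singleton (0 : ℝ)).compl)]
      have ih' : ∀ᵐ p ∂(μ.map S), p.1.det ≠ 0 := by
        rw [ae_map_iff hS.aemeasurable (p := fun p => p.1.det ≠ 0) (hdet (measurableSet_singleton (0 : ℝ)).compl)]
        exact ih
      filter_upwards [ih'] with p hp
      exact hnow_ac.ae_le (ae_det_step_ne_zero hh hn hK (hβ k) (γ k) hp p.2)
    exact ae_of_ae_map (hS.prodMk hnow).aemeasurable hae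

end TwoLayer

end

theorem mainTheorem4 {Ω : Type*} [MeasurableSpace Ω] (μ : Measure Ω) [IsProbabilityMeasure μ]
    (d N Ni : ℕ) (hNi : 1 ≤ Ni)
    (h : ℝ → ℝ) (hh : Differentiable ℝ h)
    (u : Fin N → Fin d → ℝ) (v : Fin N → ℝ)
    (K : Set (EuclideanSpace ℝ (Fin d)))
    (hK : K = Set.univ ∨
      (2 ≤ d ∧ 2 ≤ Ni ∧ ∃ R : ℝ, 0 < R ∧ K = Metric.closedBall 0 (R / 2)))
    (β : ℕ → Fin Ni → ℝ) (hβ : ∀ k i, 0 < β k i) (γ : ℕ → ℝ)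
    (W₀ : Ω → Matrix (Fin d) (Fin d) ℝ) (θ₀ : Ω → EuclideanSpace ℝ (Fin d))
    (hW₀ : Measurable W₀) (hθ₀ : Measurable θ₀)
    (hW₀_ac : μ.map (fun ω i j => W₀ ω i j) ≪ (volume : Measure (Fin d → Fin d → ℝ)))
    (ξ : ℕ → Fin Ni → Ω → EuclideanSpace ℝ (Fin d))
    (hξ : ∀ k i, Measurable (ξ k i))
    (s : ℝ≥0) (hs : 0 < s)
    (hξ_law : ∀ k i j, μ.map (fun ω => ξ k i ω j) = gaussianReal 0 s)
    (hξ_indep : iIndepFun (fun (p : ℕ × Fin Ni × Fin d) (ω : Ω) => ξ p.1 p.2.1 ω p.2.2) μ)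
    (hinit_indep : IndepFun (fun ω => (W₀ ω, θ₀ ω)) (fun ω k i => ξ k i ω) μ)
    (k : ℕ) :
    MeasurableSet (TwoLayer.singularEvent h u v K β γ W₀ θ₀ ξ k) ∧
    ∀ m : ℕ,
      μ⟦TwoLayer.singularEvent h u v K β γ W₀ θ₀ ξ k | TwoLayer.noiseHistory ξ m⟧ =ᵐ[μ] 0 ∧
      μ⟦TwoLayer.singularEvent h u v K β γ W₀ θ₀ ξ k |
        TwoLayer.fullHistory W₀ θ₀ ξ m⟧ =ᵐ[μ] 0 := by

  have hK' : K = Set.univ ∨ ∃ ρ : ℝ, 0 < ρ ∧ K = Metric.closedBall 0 ρ :=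
    hK.imp_right fun ⟨_, _, R, hR, hKR⟩ => ⟨R / 2, half_pos hR, hKR⟩
  have hmeas : Measurable fun ω =>
      (TwoLayer.sgdGd h u v K β γ (W₀ ω) (θ₀ ω) (fun j i => ξ j i ω) k).1.det :=
    Measurable.matrix_det (TwoLayer.measurable_matrix.1 (measurable_fst.comp
      (TwoLayer.measurable_sgdGd hh hK' β γ hW₀ hθ₀
        (measurable_pi_iff.2 fun j => measurable_pi_iff.2 fun i => hξ _ _) k)))
  have hae := TwoLayer.ae_det_sgdGd_ne_zero (u := u) (v := v) hh hNi hK hβ γ hW₀ hθ₀ hW₀_ac hξ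
    (fun k i j => by
      rw [hξ_law]
      exact gaussianReal_absolutelyContinuous 0 hs.ne') hξ_indep hinit_indep k
  have hind : (TwoLayer.singularEvent h u v K β γ W₀ θ₀ ξ k).indicator (fun _ => (1 : ℝ)) =ᵐ[μ]
      0 := by
    rw [TwoLayer.singularEvent_eq]
    filter_upwards [hae] with ω hω
    exact Set.indicator_of_notMem (s := {ω | _ = (0 : ℝ)}) hω (fun _ => (1 : ℝ))
  refine ⟨?_, fun m => ⟨?_, ?_⟩⟩
  · rw [TwoLayer.singularEvent_eq]
    exact hmeas (measurableSet_singleton (0 : ℝ))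
  -- The event is null, so the choice of conditioning σ-algebra plays no role.
  all_goals
    exact (condExp_congr_ae hind).trans (by rw [condExp_zero])
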